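/- Let $R$ be a commutative artinian ring and let $\Lambda$ be an Artin algebra over $R$, that is, an $R$-algebra (associative, with unit) that is finitely generated as an $R$-module; let $\Lambda^\circ$ denote the opposite ring, and let modules be left modules, so that $\Lambda^\circ$-modules are right $\Lambda$-modules. Assume that $\Lambda$ satisfies Auslander's condition (AC): for every finitely generated $\Lambda$-module $M$ there is an integer $b_M\ge 0$ such that for every finitely generated $\Lambda$-module $N$, if $\operatorname{Ext}^i_\Lambda(M,N)=0$ for all sufficiently large $i$, then $\operatorname{Ext}^i_\Lambda(M,N)=0$ for all $i>b_M$. If the injective dimension $\operatorname{id}_\Lambda\Lambda$ of $\Lambda$ as a $\Lambda$-module is finite, then the injective dimension $\operatorname{id}_{\Lambda^\circ}\Lambda$ of $\Lambda$ as a $\Lambda^\circ$-module is finite, with $\operatorname{id}_{\Lambda^\circ}\Lambda\le\operatorname{id}_\Lambda\Lambda$, and the finitistic dimension of $\Lambda$ is finite on both sides: the supremum of the projective dimensions of the finitely generated $\Lambda$-modules of finite projective dimension is finite, and so is the supremum of the projective dimensions of the finitely generated $\Lambda^\circ$-modules of finite projective dimension. -/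

import Mathlib

open CategoryTheory CategoryTheory.Abelian

universe u

/-- `Ext_A^{≥ n}(M, N) = 0`. -/
def ExtVanishesFrom {A : Type u} [Ring A] (n : ℕ) (M N : ModuleCat.{u} A) : Prop :=
  ∀ i : ℕ, n ≤ i → Subsingleton (Ext.{u} M N i)

/-- `b` is an Auslander bound for the left `A`-module `M`: for every finitely generated left
`A`-module `N`, if `Ext_A^{≥ n}(M, N) = 0` for some `n`, then `Ext_A^{> b}(M, N) = 0`. -/
def IsAuslanderBound {A : Type u} [Ring A] (M : ModuleCat.{u} A) (b : ℕ) : Prop :=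
  ∀ N : ModuleCat.{u} A, Module.Finite A N →
    (∃ n : ℕ, ExtVanishesFrom n M N) → ExtVanishesFrom (b + 1) M N

/-- Auslander's condition (AC) on a ring `A`: every finitely generated left `A`-module has an
Auslander bound. Every finitely generated `A`-module is isomorphic to one in the universe of
`A`, namely to a quotient of some `A ^ n`. -/
def AuslanderCondition (A : Type u) [Ring A] : Prop :=
  ∀ M : ModuleCat.{u} A, Module.Finite A M → ∃ b : ℕ, IsAuslanderBound M b

/-- The (left) finitistic dimension of a ring `A`: the supremum of the projective dimensions of
the finitely generated left `A`-modules of finite projective dimension. As for the projective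
dimension itself, the value is in `WithBot ℕ∞`, and the zero module contributes `⊥`. -/
noncomputable def finitisticDimension (A : Type u) [Ring A] : WithBot ℕ∞ :=
  sSup {d | ∃ M : ModuleCat.{u} A, Module.Finite A M ∧ projectiveDimension M = d ∧ d < ⊤}

/-! Let W be the dual of Λ into a dualizing module of the base ring. It is injective on both sides,
so D = Hom(-, W) is exact and sends finite free modules to injectives: a bound on projective
dimension becomes the same bound on the injective dimension of the dual. On finitely generated right
modules D is reflexive, and the bound transfers back (`hasProjectiveDimensionLT_of_homDual`).

Condition (AC) is needed only for Λ/J, with J the Jacobson radical. As Ext from Λ/J detects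
injective dimension, its Auslander bound b bounds the injective dimension of every finitely
generated left module for which that dimension is finite. Through D, b bounds the finitistic
dimension of Λ°.

The other ingredient is `hasProjectiveDimensionLT_of_syzygy_closed`. Let d be the injective
dimension of Λ over itself. Finitely generated modules of finite projective dimension form a
syzygy-closed class with injective dimensions at most d, so their projective dimensions are at most
d as well. Those of finite injective dimension are also syzygy-closed, because d is finite, so their
projective dimensions are at most b. In particular the injective module D(Λ°) has finite projective
dimension, hence at most d; dualizing back bounds the injective dimension of Λ over Λ° by d. -/

/-! ### Injective hulls and dualizing modules over a commutative ring -/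

/-- Every module embeds in an injective module as an essential submodule. -/
theorem Module.exists_injective_essential (R : Type u) [Ring R] (S : Type u) [AddCommGroup S]
    [Module R S] : ∃ (E : Type u) (_ : AddCommGroup E) (_ : Module R E) (i : S →ₗ[R] E),
      Module.Injective R E ∧ Function.Injective i ∧
        ∀ N : Submodule R E, N ⊓ LinearMap.range i = ⊥ → N = ⊥ := by
  obtain ⟨Q, hQ, j, hj⟩ := EnoughInjectives.presentation (ModuleCat.of R S)
  have hQ : Module.Injective R Q := Module.injective_module_of_injective_object R Q
  have hj : Function.Injective j.hom := (ModuleCat.mono_iff_injective j).1 hj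
  set T : Submodule R Q := LinearMap.range j.hom with hT
  let P : Set (Submodule R Q) := {E | T ≤ E ∧ ∀ N ≤ E, N ⊓ T = ⊥ → N = ⊥}
  obtain ⟨E, hTE, hE⟩ : ∃ E, T ≤ E ∧ Maximal (· ∈ P) E := by
    refine zorn_le_nonempty₀ P (fun c hc hchain E₀ hE₀ ↦ ⟨sSup c, ⟨?_, fun N hN hNT ↦ ?_⟩,
      fun z hz ↦ le_sSup hz⟩) T ⟨le_rfl, fun N hN h ↦ by rwa [inf_eq_left.2 hN] at h⟩
    · exact (hc hE₀).1.trans (le_sSup hE₀)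
    · rw [Submodule.eq_bot_iff]
      intro x hx
      obtain ⟨F, hF, hxF⟩ := (Submodule.mem_sSup_of_directed ⟨E₀, hE₀⟩ hchain.directedOn).1 (hN hx)
      have := (hc hF).2 (Submodule.span R {x}) (by simpa using hxF) (by
        rw [eq_bot_iff, ← hNT]
        exact inf_le_inf_right _ (by simpa using hx))
      simpa using this
  -- `E` is a maximal essential extension of `T` in `Q`, and `C` a maximal submodule meeting it
  -- trivially. The inclusion of `E` then extends to `g` on `Q ⧸ C`; the range of `g` is still
  -- essential over `T`, so it equals `E`, and `Q` retracts onto `E`.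
  obtain ⟨C, -, hC⟩ : ∃ C, ⊥ ≤ C ∧ Maximal (· ∈ {C : Submodule R Q | C ⊓ E = ⊥}) C := by
    refine zorn_le_nonempty₀ _ (fun c hc hchain C₀ hC₀ ↦ ⟨sSup c, ?_, fun z hz ↦ le_sSup hz⟩) ⊥
      (bot_inf_eq E)
    change _ = _
    rw [Submodule.eq_bot_iff]
    rintro x ⟨hx, hxE⟩
    obtain ⟨F, hF, hxF⟩ := (Submodule.mem_sSup_of_directed ⟨C₀, hC₀⟩ hchain.directedOn).1 hx
    have := hc hF
    exact (Submodule.eq_bot_iff _).1 this x ⟨hxF, hxE⟩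
  have hCE : C ⊓ E = ⊥ := hC.1
  have eq_C : ∀ D : Submodule R Q, C ≤ D → (∀ x ∈ D, x ∈ E → x = 0) → D ≤ C := fun D hCD hD ↦
    hC.2 ((Submodule.eq_bot_iff _).2 fun x hx ↦ hD x hx.1 hx.2) hCD
  have hinj : Function.Injective (C.mkQ ∘ₗ E.subtype) := by
    rw [← LinearMap.ker_eq_bot, Submodule.eq_bot_iff]
    intro x hx
    have hx : (x : Q) ∈ C := by simpa using hx
    exact Subtype.ext ((Submodule.eq_bot_iff _).1 hCE _ ⟨hx, x.2⟩)
  obtain ⟨g, hg⟩ := hQ.out _ hinj E.subtype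
  replace hg : ∀ x ∈ E, g (C.mkQ x) = x := fun x hx ↦ hg ⟨x, hx⟩
  have hgE : E ≤ LinearMap.range g := fun x hx ↦ ⟨_, hg x hx⟩
  have hrange : LinearMap.range g ≤ E := by
    refine hE.2 ⟨hTE.trans hgE, fun N hN hNT ↦ ?_⟩ hgE
    have hNE : N ⊓ E = ⊥ := hE.1.2 _ inf_le_right (by
      rw [eq_bot_iff, ← hNT]; exact inf_le_inf_right _ inf_le_left)
    have := eq_C (N.comap (g ∘ₗ C.mkQ)) (fun x hx ↦ by
      have : C.mkQ x = 0 := by simpa using hx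
      simp only [Submodule.mem_comap, LinearMap.comp_apply, this, map_zero, zero_mem]) (fun x hx hxE ↦ by
      refine (Submodule.eq_bot_iff _).1 hNE x ⟨?_, hxE⟩
      have h : g (C.mkQ x) ∈ N := hx
      rwa [hg x hxE] at h)
    rw [Submodule.eq_bot_iff]
    intro y hy
    obtain ⟨z, rfl⟩ := hN hy
    obtain ⟨x, rfl⟩ := C.mkQ_surjective z
    have hx : x ∈ C := this hy
    have : C.mkQ x = 0 := by simpa using hx
    rw [this, map_zero]
  let r : Q →ₗ[R] E := (g ∘ₗ C.mkQ).codRestrict E fun x ↦ hrange ⟨_, rfl⟩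
  have hr : ∀ x : E, r x = x := fun x ↦ Subtype.ext (hg x x.2)
  refine ⟨E, inferInstance, inferInstance, j.hom.codRestrict E fun x ↦ hTE ⟨x, rfl⟩,
    ⟨fun X Y _ _ _ _ f hf h ↦ ?_⟩, fun x y hxy ↦ hj (congrArg Subtype.val hxy), fun N hN ↦ ?_⟩
  · obtain ⟨l, hl⟩ := hQ.out f hf (E.subtype ∘ₗ h)
    exact ⟨r ∘ₗ l, fun x ↦ by simp [hl, hr]⟩
  · have := hE.1.2 (N.map E.subtype) (Submodule.map_subtype_le _ _) (by
      rw [Submodule.eq_bot_iff]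
      rintro _ ⟨⟨y, hy, rfl⟩, ⟨s, hs⟩⟩
      have : y ∈ N ⊓ LinearMap.range (j.hom.codRestrict E fun x ↦ hTE ⟨x, rfl⟩) :=
        ⟨hy, s, Subtype.ext hs⟩
      rw [hN] at this
      simpa using this)
    rw [Submodule.eq_bot_iff] at this ⊢
    exact fun x hx ↦ Subtype.ext (this x ⟨x, hx, rfl⟩)

theorem Module.Injective.exists_apply_eq {R : Type u} [Ring R] {E : Type u} [AddCommGroup E]
    [Module R E] (hE : Module.Injective R E) {M : Type u} [AddCommGroup M] [Module R M] (x : M)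
    (φ : R →ₗ[R] E) (hφ : ∀ r : R, r • x = 0 → φ r = 0) : ∃ h : M →ₗ[R] E, h x = φ 1 := by
  obtain ⟨h, hh⟩ := hE.out ((LinearMap.ker (LinearMap.toSpanSingleton R M x)).liftQ _ le_rfl)
    (LinearMap.ker_eq_bot.1 (Submodule.ker_liftQ_eq_bot _ _ _ le_rfl))
    ((LinearMap.ker (LinearMap.toSpanSingleton R M x)).liftQ φ hφ)
  refine ⟨h, ?_⟩
  have h1 : h ((1 : R) • x) = φ 1 := hh (Submodule.Quotient.mk 1)
  rwa [one_smul] at h1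

/-- A module that dualizes the modules of finite length over a commutative ring: it is an injective
cogenerator, and the dual of a simple module has length at most one. -/
structure Module.IsDualizing (R : Type u) [CommRing R] (E : Type u) [AddCommGroup E] [Module R E] :
    Prop where
  injective : Module.Injective R E
  exists_ne_zero : ∀ (M : Type u) [AddCommGroup M] [Module R M] (x : M), x ≠ 0 →
    ∃ f : M →ₗ[R] E, f x ≠ 0
  length_le_one : ∀ (M : Type u) [AddCommGroup M] [Module R M] [IsSimpleModule R M],
    Module.length R (M →ₗ[R] E) ≤ 1

/-- Take an injective essential extension of the product of all residue fields. It cogenerates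
because the annihilator of a nonzero element lies in a maximal ideal. For a simple module `R ⧸ m`,
essentiality forces every form to land in the product, and annihilation by `m` forces it into the
coordinate at `m`. -/
theorem Module.exists_isDualizing (R : Type u) [CommRing R] :
    ∃ (E : Type u) (_ : AddCommGroup E) (_ : Module R E), Module.IsDualizing R E := by
  classical
  let S := ∀ m : MaximalSpectrum R, R ⧸ m.asIdeal
  obtain ⟨E, _, _, i, hE, hi, hess⟩ := Module.exists_injective_essential R S
  refine ⟨E, inferInstance, inferInstance, hE, fun M _ _ x hx ↦ ?_, fun M _ _ _ ↦ ?_⟩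
  · obtain ⟨m, hm, hle⟩ := Ideal.exists_le_maximal (LinearMap.ker (LinearMap.toSpanSingleton R M x))
      fun h ↦ hx (by
        have : (1 : R) ∈ LinearMap.ker (LinearMap.toSpanSingleton R M x) := h ▸ Submodule.mem_top
        simpa using this)
    let q : R →ₗ[R] R ⧸ m := (Ideal.Quotient.mkₐ R m).toLinearMap
    have hq : ∀ r, q r = 0 ↔ r ∈ m := fun r ↦ by
      change Ideal.Quotient.mk m r = 0 ↔ r ∈ m
      rw [Ideal.Quotient.eq_zero_iff_mem]
    let φ : R →ₗ[R] E := i ∘ₗ (LinearMap.single R (fun m : MaximalSpectrum R ↦ R ⧸ m.asIdeal) ⟨m, hm⟩) ∘ₗ q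
    obtain ⟨h, h1⟩ := hE.exists_apply_eq x φ fun r hr ↦ by
      have : q r = 0 := (hq r).2 (hle hr)
      rw [LinearMap.comp_apply, LinearMap.comp_apply, this, map_zero, map_zero]
    refine ⟨h, fun h0 ↦ ?_⟩
    rw [h1] at h0
    have h2 := congrFun (hi (h0.trans (map_zero i).symm)) ⟨m, hm⟩
    have h3 : q 1 = 0 :=
      (Pi.single_eq_same (M := fun m : MaximalSpectrum R ↦ R ⧸ m.asIdeal) ⟨m, hm⟩ _).symm.trans h2
    exact (Ideal.ne_top_iff_one m).1 hm.ne_top ((hq 1).1 h3)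
  · obtain ⟨m, hm, ⟨e⟩⟩ := isSimpleModule_iff_quot_maximal.1 ‹IsSimpleModule R M›
    have hmem : ∀ f : M →ₗ[R] E, LinearMap.range f ≤ LinearMap.range i := by
      intro f
      by_cases hf : f = 0
      · simp [hf]
      have : IsSimpleModule R (LinearMap.range f) :=
        IsSimpleModule.congr (LinearEquiv.ofInjective f (LinearMap.injective_of_ne_zero hf)).symm
      have hatom := isSimpleModule_iff_isAtom.1 this
      by_contra hle
      exact hf (LinearMap.range_eq_bot.1 (hess _ ((hatom.not_le_iff_disjoint.1 hle).eq_bot)))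
    have hsimple : IsSimpleModule R (R ⧸ m) := IsSimpleModule.congr e.symm
    let φ : (M →ₗ[R] E) →ₗ[R] R ⧸ m :=
      { toFun f := (LinearEquiv.ofInjective i hi).symm ⟨f (e.symm 1), hmem f ⟨_, rfl⟩⟩ ⟨m, hm⟩
        map_add' f g := by
          rw [← Pi.add_apply, ← map_add]; rfl
        map_smul' r f := by
          rw [RingHom.id_apply, ← Pi.smul_apply, ← map_smul]; rfl }
    have hφ : Function.Injective φ := by
      rw [← LinearMap.ker_eq_bot, Submodule.eq_bot_iff]
      intro f hf
      set s : S := (LinearEquiv.ofInjective i hi).symm ⟨f (e.symm 1), hmem f ⟨_, rfl⟩⟩ with hs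
      have his : i s = f (e.symm 1) := by
        have := LinearEquiv.apply_symm_apply (LinearEquiv.ofInjective i hi) ⟨f (e.symm 1), hmem f ⟨_, rfl⟩⟩
        exact congrArg Subtype.val this
      have hs0 : s = 0 := by
        funext m'
        by_cases hmm : m' = ⟨m, hm⟩
        · subst hmm; exact hf
        -- Such an `r` kills `s` but acts injectively on the residue field at `m'`.
        · obtain ⟨r, hrm, hr⟩ : ∃ r ∈ m, r ∉ m'.asIdeal := by
            by_contra! hcon
            exact hmm (MaximalSpectrum.ext (hm.eq_of_le m'.isMaximal.ne_top hcon).symm)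
          have hrs : r • s = 0 := hi (by
            rw [map_smul, his, ← map_smul, ← map_smul, map_zero]
            have : r • (1 : R ⧸ m) = 0 := by
              rw [← map_one (Ideal.Quotient.mk m)]
              change Ideal.Quotient.mk m (r * 1) = 0
              simpa [Ideal.Quotient.eq_zero_iff_mem] using hrm
            rw [this, map_zero, map_zero])
          have h2 : r • s m' = 0 := congrFun hrs m'
          obtain ⟨t, ht⟩ := Ideal.Quotient.mk_surjective (s m')
          rw [← ht] at h2 ⊢
          have h3 : Ideal.Quotient.mk m'.asIdeal (r * t) = 0 := h2
          rw [Ideal.Quotient.eq_zero_iff_mem] at h3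
          exact Ideal.Quotient.eq_zero_iff_mem.2
            ((m'.isMaximal.isPrime.mem_or_mem h3).resolve_left hr)
      have hf1 : f (e.symm 1) = 0 := by rw [← his, hs0, map_zero]
      ext x
      obtain ⟨r, hr⟩ := Ideal.Quotient.mk_surjective (e x)
      have : x = r • e.symm 1 := by
        rw [← map_smul, LinearEquiv.eq_symm_apply, ← hr, ← map_one (Ideal.Quotient.mk m)]
        change _ = Ideal.Quotient.mk m (r * 1)
        rw [mul_one]
      rw [this, map_smul, hf1, smul_zero, LinearMap.zero_apply]
    exact (Module.length_le_of_injective φ hφ).trans (Module.length_eq_one R (R ⧸ m)).le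

namespace Module.IsDualizing

variable {R : Type u} [CommRing R] {E : Type u} [AddCommGroup E] [Module R E]

/-- Dualizing is exact, and each simple quotient contributes at most one to the length of the dual.
-/
theorem length_dual_le (hE : Module.IsDualizing R E) {M : Type u} [AddCommGroup M] [Module R M]
    (hM : IsFiniteLength R M) : Module.length R (M →ₗ[R] E) ≤ Module.length R M := by
  induction hM with
  | of_subsingleton =>
    rw [Module.length_eq_zero]; exact zero_le
  | @of_simple_quotient M _ _ N _ _ ih =>
    let p : (M ⧸ N →ₗ[R] E) →ₗ[R] (M →ₗ[R] E) := LinearMap.lcomp R E N.mkQ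
    let q : (M →ₗ[R] E) →ₗ[R] (N →ₗ[R] E) := LinearMap.lcomp R E N.subtype
    have hq : Function.Surjective q := fun f ↦ by
      obtain ⟨h, hh⟩ := hE.injective.out N.subtype N.subtype_injective f
      exact ⟨h, LinearMap.ext hh⟩
    have hp : Function.Injective p := fun f g hfg ↦
      LinearMap.ext fun x ↦ by
        obtain ⟨y, rfl⟩ := N.mkQ_surjective x
        exact LinearMap.congr_fun hfg y
    have hpq : Function.Exact p q := fun f ↦ by
      constructor
      · intro hf
        refine ⟨N.liftQ f fun x hx ↦ LinearMap.congr_fun hf ⟨x, hx⟩, LinearMap.ext fun x ↦ rfl⟩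
      · rintro ⟨g, rfl⟩
        ext x
        have : N.mkQ x = 0 := by simp
        change g (N.mkQ x) = 0
        rw [this, map_zero]
    rw [Module.length_eq_add_of_exact p q hp hq hpq,
      Module.length_eq_add_of_exact N.subtype N.mkQ N.subtype_injective N.mkQ_surjective
        (LinearMap.exact_subtype_mkQ N), add_comm]
    exact add_le_add ih ((hE.length_le_one _).trans (Module.length_eq_one R (M ⧸ N)).ge)

theorem isFiniteLength_dual (hE : Module.IsDualizing R E) {M : Type u} [AddCommGroup M]
    [Module R M] (hM : IsFiniteLength R M) : IsFiniteLength R (M →ₗ[R] E) := by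
  rw [← Module.length_ne_top_iff] at hM ⊢
  exact ne_top_of_le_ne_top hM (hE.length_dual_le (Module.length_ne_top_iff.1 hM))

/-- Evaluation into the double dual is injective, and the double dual is no longer than `M`, so the
cokernel has length zero. -/
theorem exists_eval (hE : Module.IsDualizing R E) {M : Type u} [AddCommGroup M] [Module R M]
    (hM : IsFiniteLength R M) (γ : (M →ₗ[R] E) →ₗ[R] E) : ∃ c : M, ∀ f, γ f = f c := by
  let ev : M →ₗ[R] ((M →ₗ[R] E) →ₗ[R] E) := LinearMap.flip LinearMap.id
  have hev : Function.Injective ev := by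
    rw [← LinearMap.ker_eq_bot, Submodule.eq_bot_iff]
    intro x hx
    by_contra h0
    obtain ⟨f, hf⟩ := hE.exists_ne_zero M x h0
    exact hf (LinearMap.congr_fun hx f)
  have hle : Module.length R ((M →ₗ[R] E) →ₗ[R] E) ≤ Module.length R M :=
    (hE.length_dual_le (hE.isFiniteLength_dual hM)).trans (hE.length_dual_le hM)
  rw [Module.length_eq_add_of_exact ev (LinearMap.range ev).mkQ hev
    (Submodule.mkQ_surjective _) (LinearMap.exact_map_mkQ_range ev)] at hle
  have h0 : Module.length R (((M →ₗ[R] E) →ₗ[R] E) ⧸ LinearMap.range ev) = 0 := by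
    have := Module.length_ne_top_iff.2 hM
    exact nonpos_iff_eq_zero.1 ((ENat.add_le_add_iff_left this).1 (by rwa [add_zero]))
  rw [Module.length_eq_zero_iff, Submodule.Quotient.subsingleton_iff] at h0
  obtain ⟨c, hc⟩ := LinearMap.range_eq_top.1 h0 γ
  exact ⟨c, fun f ↦ by rw [← hc]; rfl⟩

end Module.IsDualizing

/-! ### The dual bimodule of an algebra -/

/-- The `R`-linear dual of an `R`-algebra `L`, as a bimodule over `L`. -/
def DualBimodule (R L E : Type u) [CommRing R] [Ring L] [Algebra R L] [AddCommGroup E]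
    [Module R E] : Type u := L →ₗ[R] E

namespace DualBimodule

variable {R L E : Type u} [CommRing R] [Ring L] [Algebra R L] [AddCommGroup E] [Module R E]

instance : AddCommGroup (DualBimodule R L E) := inferInstanceAs (AddCommGroup (L →ₗ[R] E))

instance : Module R (DualBimodule R L E) := inferInstanceAs (Module R (L →ₗ[R] E))

instance : FunLike (DualBimodule R L E) L E := inferInstanceAs (FunLike (L →ₗ[R] E) L E)

instance : LinearMapClass (DualBimodule R L E) R L E :=
  inferInstanceAs (LinearMapClass (L →ₗ[R] E) R L E)

@[ext]
theorem ext {f g : DualBimodule R L E} (h : ∀ x, f x = g x) : f = g := DFunLike.ext _ _ h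

@[simp]
theorem add_apply (f g : DualBimodule R L E) (x : L) : (f + g) x = f x + g x := rfl

@[simp]
theorem zero_apply (x : L) : (0 : DualBimodule R L E) x = 0 := rfl

@[simp]
theorem smul_apply (r : R) (f : DualBimodule R L E) (x : L) : (r • f) x = r • f x := rfl

instance : Module L (DualBimodule R L E) where
  smul a f := LinearMap.comp (f : L →ₗ[R] E) (LinearMap.mulRight R a)
  one_smul f := ext fun x ↦ congrArg f (mul_one x)
  mul_smul a b f := ext fun x ↦ congrArg f (mul_assoc x a b).symm
  smul_zero _ := rfl
  smul_add _ _ _ := rfl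
  add_smul a b f := ext fun x ↦ (congrArg f (mul_add x a b)).trans (map_add f _ _)
  zero_smul f := ext fun x ↦ (congrArg f (mul_zero x)).trans (map_zero f)

instance : Module Lᵐᵒᵖ (DualBimodule R L E) where
  smul a f := LinearMap.comp (f : L →ₗ[R] E) (LinearMap.mulLeft R a.unop)
  one_smul f := ext fun x ↦ congrArg f (one_mul x)
  mul_smul a b f := ext fun x ↦ congrArg f (mul_assoc b.unop a.unop x)
  smul_zero _ := rfl
  smul_add _ _ _ := rfl
  add_smul a b f := ext fun x ↦ (congrArg f (add_mul a.unop b.unop x)).trans (map_add f _ _)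
  zero_smul f := ext fun x ↦ (congrArg f (zero_mul x)).trans (map_zero f)

theorem left_smul_apply (a : L) (f : DualBimodule R L E) (x : L) : (a • f) x = f (x * a) := rfl

theorem right_smul_apply (a : Lᵐᵒᵖ) (f : DualBimodule R L E) (x : L) :
    (a • f) x = f (a.unop * x) := rfl

instance : SMulCommClass L Lᵐᵒᵖ (DualBimodule R L E) where
  smul_comm a b f := ext fun x ↦ congrArg f (mul_assoc b.unop x a).symm

instance : SMulCommClass Lᵐᵒᵖ L (DualBimodule R L E) := SMulCommClass.symm _ _ _

instance : IsScalarTower R L (DualBimodule R L E) where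
  smul_assoc r a f := ext fun x ↦ by
    rw [left_smul_apply, mul_smul_comm, map_smul, smul_apply, left_smul_apply]

/-- An `R`-linear form on `L`, seen in the dual bimodule. -/
def ofLinearMap (f : L →ₗ[R] E) : DualBimodule R L E := f

/-- Evaluation at `1` identifies `L`-linear maps into the coinduced module with `R`-linear maps into
`E`, where extensions exist. -/
theorem injective_left (hE : Module.Injective R E) : Module.Injective L (DualBimodule R L E) := by
  refine Module.Baer.injective fun I g ↦ ?_
  let g₁ : I →ₗ[R] E :=
    { toFun i := g i 1
      map_add' i j := by rw [map_add, add_apply]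
      map_smul' r i := by
        rw [RingHom.id_apply, ← smul_apply, ← algebraMap_smul L r (g i), ← map_smul, algebraMap_smul] }
  obtain ⟨φ, hφ⟩ := hE.out (I.subtype.restrictScalars R) I.subtype_injective g₁
  refine ⟨{ toFun a := ofLinearMap (φ ∘ₗ LinearMap.mulRight R a)
            map_add' a b := ext fun x ↦ (congrArg φ (mul_add x a b)).trans (map_add φ _ _)
            map_smul' a b := ext fun x ↦ congrArg φ (mul_assoc x a b).symm }, fun i hi ↦ ext fun x ↦ ?_⟩
  refine (hφ ⟨x * i, I.mul_mem_left x hi⟩).trans ?_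
  change g (x • ⟨i, hi⟩) 1 = _
  rw [map_smul, left_smul_apply, one_mul]

/-- The map from right `L`-linear forms to the dual bimodule. -/
def ofOpLinearMap (φ : Lᵐᵒᵖ →ₗ[R] E) : Lᵐᵒᵖ →ₗ[Lᵐᵒᵖ] DualBimodule R L E where
  toFun a := ofLinearMap
    (φ ∘ₗ LinearMap.mulRight R a ∘ₗ (MulOpposite.opLinearEquiv R : L ≃ₗ[R] Lᵐᵒᵖ).toLinearMap)
  map_add' a b := ext fun x ↦ (congrArg φ (mul_add (MulOpposite.op x) a b)).trans (map_add φ _ _)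
  map_smul' a b := ext fun x ↦ congrArg φ (mul_assoc (MulOpposite.op x) a b).symm

theorem op_algebraMap_smul (r : R) (f : DualBimodule R L E) :
    algebraMap R Lᵐᵒᵖ r • f = r • f := ext fun x ↦ by
  rw [right_smul_apply, smul_apply, ← map_smul, Algebra.smul_def]; rfl

theorem injective_right (hE : Module.Injective R E) :
    Module.Injective Lᵐᵒᵖ (DualBimodule R L E) := by
  refine Module.Baer.injective fun I g ↦ ?_
  let g₁ : I →ₗ[R] E :=
    { toFun i := g i 1
      map_add' i j := by rw [map_add, add_apply]
      map_smul' r i := by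
        rw [← smul_apply, ← op_algebraMap_smul, ← map_smul, algebraMap_smul]; rfl }
  obtain ⟨φ, hφ⟩ := hE.out (I.subtype.restrictScalars R) I.subtype_injective g₁
  refine ⟨ofOpLinearMap φ, fun i hi ↦ ext fun x ↦ ?_⟩
  refine (hφ ⟨MulOpposite.op x * i, I.mul_mem_left _ hi⟩).trans ?_
  change g (MulOpposite.op x • ⟨i, hi⟩) 1 = _
  rw [map_smul, right_smul_apply, MulOpposite.unop_op, mul_one]

theorem exists_ne_zero (hE : Module.IsDualizing R E) {X : Type u} [AddCommGroup X]
    [Module Lᵐᵒᵖ X] {x : X} (hx : x ≠ 0) : ∃ f : X →ₗ[Lᵐᵒᵖ] DualBimodule R L E, f x ≠ 0 := by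
  let I : Submodule Lᵐᵒᵖ Lᵐᵒᵖ := LinearMap.ker (LinearMap.toSpanSingleton Lᵐᵒᵖ X x)
  have hI : ∀ a, a ∈ I ↔ a • x = 0 := fun a ↦ by simp [I]
  obtain ⟨φ, hφ⟩ := hE.exists_ne_zero (Lᵐᵒᵖ ⧸ I) (I.mkQ 1) (by
    rw [Submodule.mkQ_apply, Ne, Submodule.Quotient.mk_eq_zero, hI, one_smul]; exact hx)
  obtain ⟨f, hf⟩ := (injective_right hE.injective).exists_apply_eq x
    (ofOpLinearMap (φ ∘ₗ I.mkQ.restrictScalars R)) (fun a ha ↦ ext fun y ↦ by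
      have : I.mkQ (MulOpposite.op y * a) = 0 := by
        rw [Submodule.mkQ_apply, Submodule.Quotient.mk_eq_zero]
        exact I.smul_mem (MulOpposite.op y) ((hI a).2 ha)
      change φ (I.mkQ (MulOpposite.op y * a)) = 0
      rw [this, map_zero])
  refine ⟨f, fun h ↦ hφ ?_⟩
  have h1 : f x 1 = φ (I.mkQ (MulOpposite.op 1 * 1)) := by rw [hf]; rfl
  rw [h, zero_apply, MulOpposite.op_one, mul_one] at h1
  exact h1.symm

/-- The form sending `f` to `g f 1` on the dual of `L` is evaluation at some `c`; `L`-linearity then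
determines `g f` at every point. -/
theorem exists_eq_smul (hE : Module.IsDualizing R E) (hL : IsFiniteLength R L)
    (g : DualBimodule R L E →ₗ[L] DualBimodule R L E) : ∃ a : Lᵐᵒᵖ, ∀ f, g f = a • f := by
  obtain ⟨c, hc⟩ := hE.exists_eval hL
    { toFun f := g (ofLinearMap f) 1
      map_add' f h := by
        rw [← add_apply, ← map_add]; rfl
      map_smul' r f := by
        rw [RingHom.id_apply, ← smul_apply, ← algebraMap_smul L r (g _), ← map_smul,
          algebraMap_smul]; rfl }
  refine ⟨MulOpposite.op c, fun f ↦ ext fun x ↦ ?_⟩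
  have h1 : (g (x • f)) 1 = (x • f) c := hc (x • f)
  rw [map_smul, left_smul_apply, one_mul] at h1
  exact h1

theorem finite_left (hE : Module.IsDualizing R E) (hL : IsFiniteLength R L) :
    Module.Finite L (DualBimodule R L E) := by
  have : IsNoetherian R (DualBimodule R L E) :=
    (isFiniteLength_iff_isNoetherian_isArtinian.1 (hE.isFiniteLength_dual hL)).1
  have : Module.Finite R (DualBimodule R L E) := inferInstance
  exact Module.Finite.of_restrictScalars_finite R L _

end DualBimodule

/-! ### Ext criteria for projective and injective dimension -/

namespace ModuleCat

variable {A : Type u} [Ring A]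

/-- The free module of rank `k`. -/
abbrev freeFin (A : Type u) [Ring A] (k : ℕ) : ModuleCat.{u} A := ModuleCat.of A (Fin k → A)

theorem exists_presentation [IsNoetherianRing A] (X : ModuleCat.{u} A) [Module.Finite A X] :
    ∃ (k : ℕ) (K : ModuleCat.{u} A) (i : K ⟶ freeFin A k) (p : freeFin A k ⟶ X) (w : i ≫ p = 0),
      (ShortComplex.mk i p w).ShortExact ∧ Module.Finite A K := by
  obtain ⟨k, f, hf⟩ := Module.Finite.exists_fin' A X
  refine ⟨k, ModuleCat.of A (LinearMap.ker f), ModuleCat.ofHom (LinearMap.ker f).subtype,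
    ModuleCat.ofHom f, by ext x; exact x.2, ?_, inferInstanceAs (Module.Finite A (LinearMap.ker f))⟩
  exact ModuleCat.shortComplex_shortExact _ (LinearMap.exact_subtype_ker_map f)
    (Submodule.subtype_injective _) hf

instance (k : ℕ) : Projective (freeFin A k) :=
  (IsProjective.iff_projective (freeFin A k)).1 inferInstance

theorem hasInjectiveDimensionLT_free {n : ℕ} (h : HasInjectiveDimensionLT (ModuleCat.of A A) n)
    (k : ℕ) : HasInjectiveDimensionLT (freeFin A k) n := by
  induction k with
  | zero =>
    have : HasInjectiveDimensionLT (freeFin A 0) 0 :=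
      (ModuleCat.isZero_of_subsingleton (freeFin A 0)).hasInjectiveDimensionLT_zero
    exact hasInjectiveDimensionLT_of_ge _ 0 n (Nat.zero_le _)
  | succ k ih =>
    let e : freeFin A (k + 1) ≅ ModuleCat.of A A ⊞ freeFin A k :=
      (Fin.consLinearEquiv A (fun _ : Fin (k + 1) ↦ A)).symm.toModuleIso ≪≫
        (ModuleCat.biprodIsoProd (ModuleCat.of A A) (freeFin A k)).symm
    exact hasInjectiveDimensionLT_of_iso e.symm n

theorem projective_of_subsingleton_ext_one {K F X : ModuleCat.{u} A} {i : K ⟶ F} {p : F ⟶ X}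
    {w : i ≫ p = 0} (hS : (ShortComplex.mk i p w).ShortExact) [Projective F]
    (h : Subsingleton (Ext.{u} X K 1)) : Projective X := by
  obtain ⟨s, hs⟩ := Ext.covariant_sequence_exact₃ X hS (Ext.mk₀ (𝟙 X)) (zero_add 1)
    (Subsingleton.elim _ _)
  obtain ⟨s, rfl⟩ := Ext.homEquiv₀.symm.surjective s
  have hs : s ≫ p = 𝟙 X := Ext.homEquiv₀.symm.injective (by simpa using hs)
  exact Retract.projective ⟨s, p, hs⟩

/-- In a class of finitely generated modules that is closed under syzygies, a module has projective
dimension at most `j` if its extension groups into the modules of the class vanish above `j`. -/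
theorem hasProjectiveDimensionLT_of_syzygy_closed [IsNoetherianRing A]
    {C : ModuleCat.{u} A → Prop} (hfin : ∀ X, C X → Module.Finite A X)
    (hsyz : ∀ ⦃X⦄, C X → ∀ ⦃k : ℕ⦄ ⦃K : ModuleCat.{u} A⦄ ⦃i : K ⟶ freeFin A k⦄ ⦃p : freeFin A k ⟶ X⦄
      ⦃w : i ≫ p = 0⦄, (ShortComplex.mk i p w).ShortExact → Module.Finite A K → C K)
    (j : ℕ) {X : ModuleCat.{u} A} (hX : C X)
    (hExt : ∀ Y, C Y → ExtVanishesFrom (j + 1) X Y) : HasProjectiveDimensionLT X (j + 1) := by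
  induction j generalizing X with
  | zero =>
    have := hfin X hX
    obtain ⟨k, K, i, p, w, hS, hK⟩ := exists_presentation X
    -- The test module is the syzygy `K` itself: closure under syzygies puts it in the class, and
    -- vanishing of Ext¹ splits the presentation.
    have := projective_of_subsingleton_ext_one hS (hExt K (hsyz hX hS hK) 1 le_rfl)
    infer_instance
  | succ j ih =>
    have := hfin X hX
    obtain ⟨k, K, i, p, w, hS, hK⟩ := exists_presentation X
    have hCK := hsyz hX hS hK
    have : HasProjectiveDimensionLT K (j + 1) := by
      -- Dimension shift along the presentation; here `m` is positive, so Ext from the free module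
      -- vanishes.
      refine ih hCK fun Y hY m hm ↦ subsingleton_of_forall_eq 0 fun x ↦ ?_
      obtain _ | m := m
      · lia
      obtain ⟨y, rfl⟩ := Ext.contravariant_sequence_exact₁ hS Y x (add_comm 1 (m + 1))
        ((hExt Y hY (m + 2) (by lia)).elim _ _)
      rw [y.eq_zero_of_projective, Ext.comp_zero]
    exact (hS.hasProjectiveDimensionLT_X₃_iff j inferInstance).2 this

theorem injective_of_subsingleton_ext_one {N : ModuleCat.{u} A}
    (h : ∀ I : Ideal A, Subsingleton (Ext.{u} (ModuleCat.of A (A ⧸ I)) N 1)) : Injective N := by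
  refine (Module.injective_iff_injective_object A N).1 (Module.Baer.injective fun I g ↦ ?_)
  have hS : (ShortComplex.mk (ModuleCat.ofHom I.subtype) (ModuleCat.ofHom I.mkQ)
      (by ext x; simp)).ShortExact :=
    ModuleCat.shortComplex_shortExact _ (LinearMap.exact_subtype_mkQ I)
      I.subtype_injective I.mkQ_surjective
  obtain ⟨s, hs⟩ := Ext.contravariant_sequence_exact₁ hS N (Ext.mk₀ (ModuleCat.ofHom g))
    (add_zero 1) ((h I).elim _ _)
  obtain ⟨s, rfl⟩ := Ext.homEquiv₀.symm.surjective s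
  have hs : ModuleCat.ofHom I.subtype ≫ s = ModuleCat.ofHom g :=
    Ext.homEquiv₀.symm.injective (by simpa using hs)
  exact ⟨s.hom, fun x hx ↦ LinearMap.congr_fun (congrArg ModuleCat.Hom.hom hs) ⟨x, hx⟩⟩

/-- Baer's criterion for the injective dimension. -/
theorem hasInjectiveDimensionLT_of_subsingleton_ext {m : ℕ} {N : ModuleCat.{u} A}
    (h : ∀ I : Ideal A, Subsingleton (Ext.{u} (ModuleCat.of A (A ⧸ I)) N (m + 1))) :
    HasInjectiveDimensionLT N (m + 1) := by
  induction m generalizing N with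
  | zero =>
    have := injective_of_subsingleton_ext_one h
    infer_instance
  | succ m ih =>
    obtain ⟨J, _, f, _⟩ := EnoughInjectives.presentation N
    have hS : (ShortComplex.mk f (Limits.cokernel.π f) (Limits.cokernel.condition f)).ShortExact :=
      { exact := ShortComplex.exact_cokernel f }
    refine (hS.hasInjectiveDimensionLT_X₃_iff m inferInstance).1 (ih fun I ↦
      subsingleton_of_forall_eq 0 fun x ↦ ?_)
    obtain ⟨y, rfl⟩ := Ext.covariant_sequence_exact₃ _ hS x rfl ((h I).elim _ _)
    rw [y.eq_zero_of_injective, Ext.zero_comp]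

theorem subsingleton_ext_of_retract {X Y N : ModuleCat.{u} A} (r : Retract X Y) {m : ℕ}
    (h : Subsingleton (Ext.{u} Y N m)) : Subsingleton (Ext.{u} X N m) :=
  subsingleton_of_forall_eq 0 fun x ↦ by
    rw [← x.mk₀_id_comp, ← r.retract, ← Ext.mk₀_comp_mk₀, Ext.comp_assoc_of_second_deg_zero,
      h.elim ((Ext.mk₀ r.r).comp x (zero_add m)) 0, Ext.comp_zero]

theorem subsingleton_ext_of_isFiniteLength {N : ModuleCat.{u} A} {m : ℕ}
    (h : ∀ (T : Type u) [AddCommGroup T] [Module A T] [IsSimpleModule A T],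
      Subsingleton (Ext.{u} (ModuleCat.of A T) N m))
    {X : Type u} [AddCommGroup X] [Module A X] (hX : IsFiniteLength A X) :
    Subsingleton (Ext.{u} (ModuleCat.of A X) N m) := by
  induction hX with
  | @of_subsingleton X _ _ _ =>
    refine subsingleton_of_forall_eq 0 fun x ↦ ?_
    rw [← x.mk₀_id_comp, (ModuleCat.isZero_of_subsingleton (ModuleCat.of A X)).eq_zero_of_tgt (𝟙 _),
      Ext.mk₀_zero, Ext.zero_comp]
  | @of_simple_quotient X _ _ Y _ _ ih =>
    have hS : (ShortComplex.mk (ModuleCat.ofHom Y.subtype) (ModuleCat.ofHom Y.mkQ)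
        (by ext x; simp)).ShortExact :=
      ModuleCat.shortComplex_shortExact _ (LinearMap.exact_subtype_mkQ Y)
        Y.subtype_injective Y.mkQ_surjective
    refine subsingleton_of_forall_eq 0 fun x ↦ ?_
    obtain ⟨y, rfl⟩ := Ext.contravariant_sequence_exact₂ hS N x (ih.elim _ _)
    rw [(h (X ⧸ Y)).elim y 0, Ext.comp_zero]

/-- Over an artinian ring, the injective dimension is detected by the extensions of the largest
semisimple quotient of the ring. -/
theorem hasInjectiveDimensionLT_of_subsingleton_ext_jacobson [IsArtinianRing A]
    {N : ModuleCat.{u} A} {m : ℕ}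
    (h : Subsingleton (Ext.{u} (ModuleCat.of A (A ⧸ Ring.jacobson A)) N (m + 1))) :
    HasInjectiveDimensionLT N (m + 1) := by
  refine hasInjectiveDimensionLT_of_subsingleton_ext fun I ↦
    subsingleton_ext_of_isFiniteLength (fun T _ _ _ ↦ ?_)
      (isFiniteLength_iff_isNoetherian_isArtinian.2 ⟨inferInstance, inferInstance⟩)
  have := IsSimpleModule.nontrivial A T
  obtain ⟨t, ht⟩ := exists_ne (0 : T)
  -- The radical kills the simple module `T`, so `T` is a quotient of `A ⧸ Ring.jacobson A`;
  -- semisimplicity makes it a retract.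
  let f : A ⧸ Ring.jacobson A →ₗ[A] T := (Ring.jacobson A).liftQ (LinearMap.toSpanSingleton A T t)
    fun a ha ↦ Module.mem_annihilator.1 (IsSemisimpleModule.jacobson_le_annihilator A T ha) t
  have hf : Function.Surjective f := by
    refine LinearMap.surjective_of_ne_zero fun h0 ↦ ht ?_
    have h1 : f (Submodule.Quotient.mk 1) = (1 : A) • t := rfl
    rwa [h0, LinearMap.zero_apply, one_smul, eq_comm] at h1
  have : IsSemisimpleModule A (A ⧸ Ring.jacobson A) :=
    (IsArtinian.isSemisimpleModule_iff_jacobson A _).2 (Module.jacobson_quotient_jacobson A A)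
  obtain ⟨s, hs⟩ := IsSemisimpleModule.lifting_property f hf LinearMap.id
  exact subsingleton_ext_of_retract ⟨ModuleCat.ofHom s, ModuleCat.ofHom f, by
    rw [← ModuleCat.ofHom_comp, hs]; rfl⟩ h

end ModuleCat

/-! ### Duality into a bimodule -/

namespace ModuleCat

variable {A B : Type u} [Ring A] [Ring B] (W : Type u) [AddCommGroup W] [Module A W] [Module B W]
  [SMulCommClass A B W]

/-- The `B`-module of `A`-linear maps from `X` to the bimodule `W`. -/
abbrev homDual (B : Type u) [Ring B] [Module B W] [SMulCommClass A B W] (X : ModuleCat.{u} A) :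
    ModuleCat.{u} B := ModuleCat.of B (X →ₗ[A] W)

/-- The contravariant functoriality of `homDual`. -/
def homDualMap {X Y : ModuleCat.{u} A} (f : X ⟶ Y) : homDual W B Y ⟶ homDual W B X :=
  ModuleCat.ofHom
    { toFun g := g ∘ₗ f.hom
      map_add' _ _ := rfl
      map_smul' _ _ := rfl }

theorem homDualMap_comp {X Y Z : ModuleCat.{u} A} (f : X ⟶ Y) (g : Y ⟶ Z) :
    homDualMap W g ≫ homDualMap W f = homDualMap (B := B) W (f ≫ g) := rfl

theorem homDualMap_id (X : ModuleCat.{u} A) : homDualMap (B := B) W (𝟙 X) = 𝟙 _ := rfl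

theorem homDualMap_zero (X Y : ModuleCat.{u} A) :
    homDualMap (B := B) W (0 : X ⟶ Y) = 0 := by
  ext g x
  exact map_zero g

theorem homDualMap_comp_eq_zero {X Y Z : ModuleCat.{u} A} {f : X ⟶ Y} {g : Y ⟶ Z}
    (w : f ≫ g = 0) : homDualMap (B := B) W g ≫ homDualMap W f = 0 := by
  rw [homDualMap_comp, w, homDualMap_zero]

variable {W}

theorem shortExact_homDual (hA : Module.Injective A W) {K F X : ModuleCat.{u} A} {i : K ⟶ F}
    {p : F ⟶ X} {w : i ≫ p = 0} (hS : (ShortComplex.mk i p w).ShortExact) :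
    (ShortComplex.mk (homDualMap (B := B) W p) (homDualMap W i)
      (homDualMap_comp_eq_zero W w)).ShortExact := by
  have hp : Function.Surjective p.hom := (ModuleCat.epi_iff_surjective p).1 hS.epi_g
  have hi : Function.Injective i.hom := (ModuleCat.mono_iff_injective i).1 hS.mono_f
  refine ModuleCat.shortComplex_shortExact _ (fun f ↦ ⟨fun hf ↦ ?_, ?_⟩) (fun f g hfg ↦ ?_)
    (fun f ↦ ?_)
  · have hker : LinearMap.ker p.hom ≤ LinearMap.ker f := fun x hx ↦ by
      obtain ⟨y, rfl⟩ := (ShortComplex.moduleCat_exact_iff _).1 hS.exact x hx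
      exact LinearMap.congr_fun hf y
    refine ⟨(LinearMap.ker p.hom).liftQ f hker ∘ₗ
      (p.hom.quotKerEquivOfSurjective hp).symm.toLinearMap, LinearMap.ext fun x ↦ ?_⟩
    change (LinearMap.ker p.hom).liftQ f hker ((p.hom.quotKerEquivOfSurjective hp).symm (p.hom x)) = f x
    have : (p.hom.quotKerEquivOfSurjective hp).symm (p.hom x) = Submodule.Quotient.mk x := by
      rw [LinearEquiv.symm_apply_eq]; rfl
    rw [this]; rfl
  · rintro ⟨g, rfl⟩
    exact congrArg (fun h ↦ h.hom g) (homDualMap_comp_eq_zero (B := B) W w)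
  · refine LinearMap.ext fun x ↦ ?_
    obtain ⟨y, rfl⟩ := hp x
    exact LinearMap.congr_fun hfg y
  · obtain ⟨h, hh⟩ := hA.out i.hom hi f
    exact ⟨h, LinearMap.ext hh⟩

theorem injective_homDual_free (hB : Module.Injective B W) (k : ℕ) :
    Injective (homDual W B (freeFin A k)) := by
  have : Injective (ModuleCat.of B (Fin k → W)) := Module.injective_object_of_injective_module B _
  exact Injective.of_iso (LinearEquiv.piRing A W (Fin k) B).symm.toModuleIso this

/-- Duality turns a syzygy sequence into a cosyzygy sequence with injective middle term. -/
theorem hasInjectiveDimensionLT_homDual [IsNoetherianRing A] (hA : Module.Injective A W)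
    (hB : Module.Injective B W) (n : ℕ) (X : ModuleCat.{u} A) [Module.Finite A X]
    [hX : HasProjectiveDimensionLT X (n + 1)] :
    HasInjectiveDimensionLT (homDual W B X) (n + 1) := by
  obtain ⟨k, K, i, p, w, hS, hK⟩ := exists_presentation X
  have := injective_homDual_free (A := A) (B := B) hB k
  induction n generalizing X k K with
  | zero =>
    have : Projective X := projective_iff_hasProjectiveDimensionLT_one.2 hX
    have : Epi p := hS.epi_g
    have r : Retract (homDual W B X) (homDual W B (freeFin A k)) :=
      ⟨homDualMap W p, homDualMap W (Projective.factorThru (𝟙 X) p), by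
        rw [homDualMap_comp, Projective.factorThru_comp, homDualMap_id]⟩
    exact r.hasInjectiveDimensionLT 1
  | succ n ih =>
    have := (hS.hasProjectiveDimensionLT_X₃_iff n inferInstance).1 hX
    obtain ⟨k', K', i', p', w', hS', hK'⟩ := exists_presentation K
    have := ih K k' K' i' p' w' hS' hK' (injective_homDual_free hB k')
    exact ((shortExact_homDual hA hS).hasInjectiveDimensionLT_X₃_iff n ‹_›).1 this

theorem finite_homDual [IsNoetherianRing B] [Module.Finite B W] (X : ModuleCat.{u} A)
    [Module.Finite A X] : Module.Finite B (homDual W B X) := by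
  obtain ⟨k, f, hf⟩ := Module.Finite.exists_fin' A X
  have hinj : Function.Injective (homDualMap (B := B) W (ModuleCat.ofHom f)).hom :=
    fun g h hgh ↦ LinearMap.ext fun x ↦ by
      obtain ⟨y, rfl⟩ := hf x
      exact LinearMap.congr_fun hgh y
  have : Module.Finite B ((Fin k → A) →ₗ[A] W) :=
    Module.Finite.equiv (LinearEquiv.piRing A W (Fin k) B).symm
  exact Module.Finite.of_injective _ hinj

section Reflexive

variable [SMulCommClass B A W] (hB : Module.Injective B W)
  (hW : ∀ (X : Type u) [AddCommGroup X] [Module A X] (x : X), x ≠ 0 → ∃ f : X →ₗ[A] W, f x ≠ 0)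
  (hend : ∀ g : W →ₗ[B] W, ∃ a : A, ∀ w, g w = a • w)

/-- Evaluation into the double dual. -/
def evalDual (B : Type u) [Ring B] (W : Type u) [AddCommGroup W] [Module A W] [Module B W]
    [SMulCommClass A B W] [SMulCommClass B A W] (X : Type u) [AddCommGroup X] [Module A X] :
    X →ₗ[A] ((X →ₗ[A] W) →ₗ[B] W) where
  toFun x :=
    { toFun f := f x
      map_add' _ _ := rfl
      map_smul' _ _ := rfl }
  map_add' x y := LinearMap.ext fun f ↦ map_add f x y
  map_smul' a x := LinearMap.ext fun f ↦ map_smul f a x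

include hW in
theorem evalDual_injective (X : Type u) [AddCommGroup X] [Module A X] :
    Function.Injective (evalDual (A := A) B W X) := by
  rw [← LinearMap.ker_eq_bot, Submodule.eq_bot_iff]
  intro x hx
  by_contra h0
  obtain ⟨f, hf⟩ := hW X x h0
  exact hf (LinearMap.congr_fun hx f)

-- For surjectivity, values on generators embed the dual of `X` in a power of `W`. A form on the
-- dual extends to that power, and its components are endomorphisms of `W`, hence scalars: they are
-- the coefficients of the required element.
include hB hW hend in
theorem evalDual_bijective (X : Type u) [AddCommGroup X] [Module A X] [Module.Finite A X] :
    Function.Bijective (evalDual (A := A) B W X) := by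
  refine ⟨evalDual_injective hW X, fun g ↦ ?_⟩
  obtain ⟨k, s, hs⟩ := Module.Finite.exists_fin (R := A) (M := X)
  let ev : (X →ₗ[A] W) →ₗ[B] (Fin k → W) :=
    { toFun f i := f (s i)
      map_add' _ _ := rfl
      map_smul' _ _ := rfl }
  have hev : Function.Injective ev := fun f h hfh ↦
    LinearMap.ext_on_range hs fun i ↦ congrFun hfh i
  obtain ⟨g', hg'⟩ := hB.out ev hev g
  choose c hc using fun i ↦ hend (g' ∘ₗ LinearMap.single B (fun _ ↦ W) i)
  refine ⟨∑ i, c i • s i, LinearMap.ext fun f ↦ ?_⟩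
  rw [← hg' f, ← Finset.univ_sum_single (ev f), map_sum g']
  refine (map_sum f _ _).trans (Finset.sum_congr rfl fun i _ ↦ ?_)
  rw [map_smul]
  exact (hc i (f (s i))).symm

-- A free cover of `X` dualizes to a monomorphism, which splits. Dualizing the retraction and using
-- reflexivity of the free module gives a section of the cover.
include hB hW hend in
theorem projective_of_injective_homDual (X : ModuleCat.{u} A) [Module.Finite A X]
    [Injective (homDual W B X)] : Projective X := by
  obtain ⟨k, f, hf⟩ := Module.Finite.exists_fin' A X
  have hmono : Mono (homDualMap (B := B) W (ModuleCat.ofHom f)) :=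
    (ModuleCat.mono_iff_injective _).2 fun g h hgh ↦ LinearMap.ext fun x ↦ by
      obtain ⟨y, rfl⟩ := hf x
      exact LinearMap.congr_fun hgh y
  let ρ := Injective.factorThru (𝟙 (homDual W B X)) (homDualMap (B := B) W (ModuleCat.ofHom f))
  have hρ : ∀ g : X →ₗ[A] W, ρ.hom (g ∘ₗ f) = g := fun g ↦
    congrArg (fun h ↦ h.hom g)
      (Injective.comp_factorThru (𝟙 (homDual W B X)) (homDualMap (B := B) W (ModuleCat.ofHom f)))
  let η := LinearEquiv.ofBijective _ (evalDual_bijective hB hW hend (Fin k → A))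
  let s : X →ₗ[A] (Fin k → A) := η.symm.toLinearMap ∘ₗ
    { toFun x := evalDual B W X x ∘ₗ ρ.hom
      map_add' x y := by rw [map_add, LinearMap.add_comp]
      map_smul' a x := by rw [map_smul, LinearMap.smul_comp]; rfl }
  have hs : ∀ (x : X) (h : (Fin k → A) →ₗ[A] W), h (s x) = ρ.hom h x := fun x h ↦
    LinearMap.congr_fun (η.apply_symm_apply (evalDual B W X x ∘ₗ ρ.hom)) h
  have hfs : ModuleCat.ofHom s ≫ ModuleCat.ofHom f = 𝟙 X := by
    ext x
    refine evalDual_injective (B := B) hW X (LinearMap.ext fun g ↦ ?_)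
    change (g ∘ₗ f) (s x) = g x
    rw [hs, hρ]
  exact Retract.projective (Y := freeFin A k) ⟨ModuleCat.ofHom s, ModuleCat.ofHom f, hfs⟩

include hB hW hend in
theorem hasProjectiveDimensionLT_of_homDual [IsNoetherianRing A] (hA : Module.Injective A W)
    (n : ℕ) (X : ModuleCat.{u} A) [Module.Finite A X]
    [hX : HasInjectiveDimensionLT (homDual W B X) (n + 1)] :
    HasProjectiveDimensionLT X (n + 1) := by
  induction n generalizing X with
  | zero =>
    have : Injective (homDual W B X) := injective_iff_hasInjectiveDimensionLT_one.2 hX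
    have := projective_of_injective_homDual hB hW hend X
    infer_instance
  | succ n ih =>
    obtain ⟨k, K, i, p, w, hS, hK⟩ := exists_presentation X
    have := ((shortExact_homDual (B := B) hA hS).hasInjectiveDimensionLT_X₃_iff n
      (injective_homDual_free hB k)).2 hX
    exact (hS.hasProjectiveDimensionLT_X₃_iff n inferInstance).2 (ih K)

end Reflexive

end ModuleCat

/-! ### Uniform bounds on homological dimensions -/

namespace ModuleCat

variable {A : Type u} [Ring A]

/-- A bound for the largest semisimple quotient bounds the injective dimensions. -/
theorem hasInjectiveDimensionLT_of_isAuslanderBound [IsArtinianRing A] {b : ℕ}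
    (hb : IsAuslanderBound (ModuleCat.of A (A ⧸ Ring.jacobson A)) b) {N : ModuleCat.{u} A}
    (hN : Module.Finite A N) {n : ℕ} [HasInjectiveDimensionLT N n] :
    HasInjectiveDimensionLT N (b + 1) :=
  hasInjectiveDimensionLT_of_subsingleton_ext_jacobson <|
    hb N hN ⟨n, fun i hi ↦ HasInjectiveDimensionLT.subsingleton N n i hi _⟩ (b + 1) le_rfl

/-- The syzygy criterion applies to the modules of finite injective dimension: `hA` gives closure
under syzygies, and `hb` makes Ext into the class vanish above `b`. -/
theorem hasProjectiveDimensionLT_of_hasInjectiveDimensionLT [IsNoetherianRing A] {d n : ℕ}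
    (hA : HasInjectiveDimensionLT (ModuleCat.of A A) d) {b : ℕ}
    (hb : ∀ (N : ModuleCat.{u} A) (m : ℕ), Module.Finite A N → HasInjectiveDimensionLT N m →
      HasInjectiveDimensionLT N (b + 1))
    (X : ModuleCat.{u} A) [Module.Finite A X] [HasInjectiveDimensionLT X n] :
    HasProjectiveDimensionLT X (b + 1) := by
  refine hasProjectiveDimensionLT_of_syzygy_closed
    (C := fun X ↦ Module.Finite A X ∧ ∃ m, HasInjectiveDimensionLT X m) (fun _ h ↦ h.1) ?_ b
    ⟨‹_›, n, ‹_›⟩ ?_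
  · rintro X ⟨_, m, hX⟩ k K i p w hS hK
    have := hasInjectiveDimensionLT_free hA k
    refine ⟨hK, m + d + 1, hS.hasInjectiveDimensionLT_X₁ (m + d) ?_ ?_⟩
    · exact hasInjectiveDimensionLT_of_ge _ m _ (by lia)
    · exact hasInjectiveDimensionLT_of_ge _ d _ (by lia)
  · rintro Y ⟨hY, m, hYm⟩ i hi
    have := hb Y m hY hYm
    exact HasInjectiveDimensionLT.subsingleton Y (b + 1) i hi X

/-- Over a noetherian ring of injective dimension at most `d`, the finitely generated modules of
finite projective dimension have injective dimension at most `d`. -/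
theorem hasInjectiveDimensionLT_of_hasProjectiveDimensionLT [IsNoetherianRing A] {d : ℕ}
    (hA : HasInjectiveDimensionLT (ModuleCat.of A A) d) (n : ℕ) (X : ModuleCat.{u} A)
    [Module.Finite A X] [hX : HasProjectiveDimensionLT X n] : HasInjectiveDimensionLT X d := by
  induction n generalizing X with
  | zero =>
    have := (isZero_of_hasProjectiveDimensionLT_zero X).hasInjectiveDimensionLT_zero
    exact hasInjectiveDimensionLT_of_ge X 0 d (Nat.zero_le d)
  | succ n ih =>
    obtain ⟨k, K, i, p, w, hS, hK⟩ := exists_presentation X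
    have hF := hasInjectiveDimensionLT_free hA k
    obtain _ | n := n
    · have : Projective X := projective_iff_hasProjectiveDimensionLT_one.2 hX
      have : Epi p := hS.epi_g
      exact Retract.hasInjectiveDimensionLT (Y := freeFin A k)
        ⟨Projective.factorThru (𝟙 X) p, p, Projective.factorThru_comp _ _⟩ d
    · have := (hS.hasProjectiveDimensionLT_X₃_iff n inferInstance).1 hX
      have : HasInjectiveDimensionLT K d := ih K
      exact hS.hasInjectiveDimensionLT_X₃ d hF (hasInjectiveDimensionLT_of_ge _ d _ (by lia))

/-- Same criterion for the modules of finite projective dimension, whose injective dimensions are at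
most `d`. -/
theorem hasProjectiveDimensionLT_of_hasProjectiveDimensionLT [IsNoetherianRing A] {d n : ℕ}
    (hA : HasInjectiveDimensionLT (ModuleCat.of A A) (d + 1)) (X : ModuleCat.{u} A)
    [Module.Finite A X] [HasProjectiveDimensionLT X n] : HasProjectiveDimensionLT X (d + 1) := by
  refine hasProjectiveDimensionLT_of_syzygy_closed
    (C := fun X ↦ Module.Finite A X ∧ ∃ m, HasProjectiveDimensionLT X m) (fun _ h ↦ h.1) ?_ d
    ⟨‹_›, n, ‹_›⟩ ?_
  · rintro X ⟨_, m, hX⟩ k K i p w hS hK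
    refine ⟨hK, m + 1, hS.hasProjectiveDimensionLT_X₁ (m + 1) ?_ ?_⟩
    · exact hasProjectiveDimensionLT_of_ge _ 1 _ (by lia)
    · exact hasProjectiveDimensionLT_of_ge _ m _ (by lia)
  · rintro Y ⟨hY, m, hYm⟩ i hi
    have := hasInjectiveDimensionLT_of_hasProjectiveDimensionLT hA m Y
    exact HasInjectiveDimensionLT.subsingleton Y (d + 1) i hi X

end ModuleCat

/-! ### Finitistic dimensions and the symmetry of injective dimension -/

theorem finitisticDimension_lt_top {A : Type u} [Ring A] (b : ℕ)
    (h : ∀ (X : ModuleCat.{u} A) (n : ℕ), Module.Finite A X → HasProjectiveDimensionLT X n →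
      HasProjectiveDimensionLT X (b + 1)) : finitisticDimension A < ⊤ := by
  refine lt_of_le_of_lt (b := ((b : ℕ∞) : WithBot ℕ∞)) (sSup_le ?_)
    (WithBot.coe_lt_coe.2 (ENat.natCast_lt_top b))
  rintro _ ⟨X, hX, rfl, hlt⟩
  obtain ⟨n, hn⟩ := (projectiveDimension_ne_top_iff X).1 hlt.ne
  exact (projectiveDimension_le_iff X b).2 (h X (n + 1) hX hn)

open ModuleCat in
/-- The symmetry of the injective dimension for artin algebras satisfying Auslander's condition, over
a base ring in the universe of the algebra. -/
theorem hasInjectiveDimensionLT_op_and_finitisticDimension_lt_top {R L : Type u} [CommRing R]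
    [IsArtinianRing R] [Ring L] [Algebra R L] [Module.Finite R L] (hAC : AuslanderCondition L)
    {n : ℕ} (hid : HasInjectiveDimensionLT (ModuleCat.of L L) (n + 1)) :
    (∀ d, HasInjectiveDimensionLT (ModuleCat.of L L) (d + 1) →
      HasInjectiveDimensionLT (ModuleCat.of Lᵐᵒᵖ L) (d + 1)) ∧
    finitisticDimension L < ⊤ ∧ finitisticDimension Lᵐᵒᵖ < ⊤ := by
  have : IsNoetherian R L := inferInstance
  have : IsArtinian R L := inferInstance
  have : IsArtinianRing L := isArtinian_of_tower R inferInstance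
  have : Module.Finite R Lᵐᵒᵖ := Module.Finite.equiv (MulOpposite.opLinearEquiv R)
  have : IsArtinianRing Lᵐᵒᵖ := isArtinian_of_tower R inferInstance
  have hfl : IsFiniteLength R L := isFiniteLength_iff_isNoetherian_isArtinian.2 ⟨‹_›, ‹_›⟩
  obtain ⟨E, _, _, hE⟩ := Module.exists_isDualizing R
  let W := DualBimodule R L E
  have hl : Module.Injective L W := DualBimodule.injective_left hE.injective
  have hr : Module.Injective Lᵐᵒᵖ W := DualBimodule.injective_right hE.injective
  have : Module.Finite L W := DualBimodule.finite_left hE hfl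
  have hW := fun (X : Type u) [AddCommGroup X] [Module Lᵐᵒᵖ X] (x : X) (hx : x ≠ 0) ↦
    DualBimodule.exists_ne_zero (R := R) (L := L) hE hx
  have hend := DualBimodule.exists_eq_smul hE hfl
  obtain ⟨b, hb⟩ := hAC (ModuleCat.of L (L ⧸ Ring.jacobson L))
    (inferInstanceAs (Module.Finite L (L ⧸ Ring.jacobson L)))
  have hinj : ∀ (N : ModuleCat.{u} L) (m : ℕ), Module.Finite L N → HasInjectiveDimensionLT N m →
      HasInjectiveDimensionLT N (b + 1) := fun N m hN hNm ↦
    hasInjectiveDimensionLT_of_isAuslanderBound hb hN (n := m)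
  refine ⟨fun d hd ↦ ?_, finitisticDimension_lt_top n fun X m _ _ ↦
    hasProjectiveDimensionLT_of_hasProjectiveDimensionLT (n := m) hid X,
    finitisticDimension_lt_top b fun X m _ _ ↦ ?_⟩
  · let I : ModuleCat.{u} L := homDual W L (ModuleCat.of Lᵐᵒᵖ Lᵐᵒᵖ)
    have : Module.Finite L I := finite_homDual _
    have : HasInjectiveDimensionLT I (0 + 1) := hasInjectiveDimensionLT_homDual hr hl 0 _
    have := hasProjectiveDimensionLT_of_hasInjectiveDimensionLT (n := 0 + 1) hid hinj I
    -- The bound `b` only serves to make the projective dimension of `I` finite; it then drops to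
    -- `d`.
    have := hasProjectiveDimensionLT_of_hasProjectiveDimensionLT (n := b + 1) hd I
    have hDI : HasInjectiveDimensionLT (homDual W Lᵐᵒᵖ I) (d + 1) :=
      hasInjectiveDimensionLT_homDual hl hr d I
    let e₁ := LinearEquiv.ofBijective _ (evalDual_bijective hl hW hend Lᵐᵒᵖ)
    let e₂ : L ≃ₗ[Lᵐᵒᵖ] Lᵐᵒᵖ :=
      { MulOpposite.opAddEquiv with map_smul' := fun a x ↦ rfl }
    exact hasInjectiveDimensionLT_of_iso (e₂.trans e₁).toModuleIso.symm (d + 1)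
  -- Dualize to a left module of finite injective dimension, apply the bound `b` there, and dualize
  -- back.
  · have : HasProjectiveDimensionLT X (m + 1) := hasProjectiveDimensionLT_of_ge X m _ (by lia)
    have := hasInjectiveDimensionLT_homDual (B := L) hr hl m X
    have := hinj (homDual W L X) _ (finite_homDual X) this
    exact hasProjectiveDimensionLT_of_homDual hl hW hend hr b X

theorem proposition3p2 {R : Type*} [CommRing R] [IsArtinianRing R]
    {L : Type u} [Ring L] [Algebra R L] [Module.Finite R L]
    (hAC : AuslanderCondition L)
    (hid : injectiveDimension (ModuleCat.of L L) < ⊤) :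
    (injectiveDimension (ModuleCat.of Lᵐᵒᵖ L) < ⊤ ∧
      injectiveDimension (ModuleCat.of Lᵐᵒᵖ L) ≤ injectiveDimension (ModuleCat.of L L)) ∧
    finitisticDimension L < ⊤ ∧ finitisticDimension Lᵐᵒᵖ < ⊤ := by
  obtain ⟨n, hn⟩ := (injectiveDimension_ne_top_iff _).1 hid.ne
  -- The center replaces `R` as base ring because it lives in the universe of `L`. It is an
  -- `R`-submodule of `L`, hence artinian.
  let : Algebra R (Subring.center L) := ((algebraMap R L).codRestrict (Subring.center L) fun r ↦
    Subring.mem_center_iff.2 fun x ↦ (Algebra.commutes r x).symm).toAlgebra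
  have : IsScalarTower R (Subring.center L) L := IsScalarTower.of_algebraMap_eq fun _ ↦ rfl
  have : IsArtinian R (Subring.center L) :=
    isArtinian_of_injective (IsScalarTower.toAlgHom R (Subring.center L) L).toLinearMap
      Subtype.val_injective
  have : IsArtinianRing (Subring.center L) := isArtinian_of_tower R inferInstance
  have : Module.Finite (Subring.center L) L := Module.Finite.of_restrictScalars_finite R _ L
  obtain ⟨h, h'⟩ := hasInjectiveDimensionLT_op_and_finitisticDimension_lt_top (R := Subring.center L) hAC hn
  have hle : injectiveDimension (ModuleCat.of Lᵐᵒᵖ L) ≤ injectiveDimension (ModuleCat.of L L) := by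
    -- For the zero ring the injective dimension is `⊥`, not a natural number.
    cases subsingleton_or_nontrivial L with
    | inl _ =>
      rw [(injectiveDimension_eq_bot_iff _).2
        (ModuleCat.isZero_of_subsingleton (ModuleCat.of Lᵐᵒᵖ L))]
      exact bot_le
    | inr _ =>
      obtain ⟨d, hd⟩ : ∃ d : ℕ, injectiveDimension (ModuleCat.of L L) = d := by
        have hbot : injectiveDimension (ModuleCat.of L L) ≠ ⊥ := fun h0 ↦
          not_subsingleton L
            (ModuleCat.subsingleton_of_isZero ((injectiveDimension_eq_bot_iff _).1 h0))
        obtain ⟨e, he⟩ := WithBot.ne_bot_iff_exists.1 hbot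
        rw [← he] at hid ⊢
        obtain ⟨d, rfl⟩ := ENat.ne_top_iff_exists.1 (WithBot.coe_lt_coe.1 hid).ne
        exact ⟨d, rfl⟩
      rw [hd]
      exact (injectiveDimension_le_iff _ d).2 (h d ((injectiveDimension_le_iff _ d).1 hd.le))
  exact ⟨⟨hle.trans_lt hid, hle⟩, h'⟩
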